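/- A finite-horizon Dec-POMDP $D$ consists of agents $\mathcal N=\{1,\dots,N\}$ ($N\ge 1$), a finite state set $\mathcal S$, finite action sets $\mathcal A_i$ and observation sets $\mathcal O_i$ ($i\in\mathcal N$), with $\mathcal A=\prod_i\mathcal A_i$ and $\mathcal O=\prod_i\mathcal O_i$, kernels $P(\cdot\mid s,a)\in\Delta(\mathcal S)$ and $O(\cdot\mid s,a)\in\Delta(\mathcal O)$, a reward $\mathcal R\colon\mathcal S\times\mathcal A\to\mathbb R$, an initial distribution $b_0\in\Delta(\mathcal S)$ and a horizon $T\in\mathbb N_0$. A local policy $\pi_i\in\Pi_i$ maps each local history $\tau_i\in\bigcup_{0\le t\le T}(\mathcal A_i\times\mathcal O_i)^t$ to an element $\pi_i(\cdot\mid\tau_i)$ of $\Delta(\mathcal A_i)$; a policy is an element $\pi$ of $\Pi=\prod_i\Pi_i$. Under $\mathbb P_\pi$ one has $S_0\sim b_0$, $S_{t+1}\sim P(\cdot\mid S_t,A_t)$, $O_{t+1}\sim O(\cdot\mid S_{t+1},A_t)$ and, independently over $i$, $A_{i,t}\sim\pi_i(\cdot\mid H_{i,t})$, where $H_{i,t}=(A_{i,0},O_{i,1},\dots,A_{i,t-1},O_{i,t})$.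 The self-play value is $J(\pi)=\mathbb E_\pi\big[\sum_{t=0}^T\mathcal R(S_t,A_t)\big]$. An automorphism $f\in\mathrm{Aut}(D)$ consists of bijections $\mathcal N\to\mathcal N$, $\mathcal S\to\mathcal S$, $\mathcal A_i\to\mathcal A_{f(i)}$, $\mathcal O_i\to\mathcal O_{f(i)}$ preserving $P$, $O$, $\mathcal R$ and $b_0$. It acts on policies by $(f^*\pi)_i(a_i\mid\tau_i)=\pi_{f^{-1}i}(f^{-1}a_i\mid f^{-1}\tau_i)$; $\pi$ is invariant to automorphism if $f^*\pi=\pi$ for all $f\in\mathrm{Aut}(D)$. For $g\in\mathrm{Aut}(D)^{\mathcal N}$ let $(g^*\pi)_i=(g_i^*\pi)_i$. The other-play value is $J_{\mathrm{OP}}(\pi)=\mathbb E_{g\sim\mathcal U(\mathrm{Aut}(D)^{\mathcal N})}[J(g^*\pi)]$, and the other-play distribution of $\pi$ is $\mu=|\mathrm{Aut}(D)|^{-N}\sum_{g\in\mathrm{Aut}(D)^{\mathcal N}}\delta_{g^*\pi}$, with marginals $\mu_i$ on $\Pi_i$. For a distribution $\nu$ on $\Pi$ let $\mathbb P_\nu$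 be the law obtained by drawing a policy from $\nu$ and then an episode from it. The symmetrized policy $\Psi(\pi)$ is the policy corresponding to $\mu$: for $0\le t\le T$ and $\tau_i\in(\mathcal A_i\times\mathcal O_i)^t$, $$\Psi(\pi)_i(a_i\mid\tau_i)=\mathbb P_{\mu_i\otimes\mu_{-i}}(A_{i,t}=a_i\mid H_{i,t}=\tau_i),$$ where $\mu_{-i}$ is any product of distributions over the local policies of the other agents with $\mathbb P_{\mu_i\otimes\mu_{-i}}(H_{i,t}=\tau_i)>0$, and $\Psi(\pi)_i(a_i\mid\tau_i)=1/|\mathcal A_i|$ if there is none. Policies $\pi,\pi'$ are equivalent if $\Psi(\pi)=\Psi(\pi')$. **Theorem.** Let $D$ be a Dec-POMDP. For every policy $\pi$, the policy $\Psi(\pi)$ is well defined (it does not depend on the choice of the $\mu_{-i}$) and invariant to automorphism, and $$J_{\mathrm{OP}}(\pi)=J(\Psi(\pi)).$$ In particular, $J_{\mathrm{OP}}$ factors through the equivalence classes of policies, and if $J_{\mathrm{OP}}$ has a maximizer over $\Pi$, then it has a maximizer that is invariant to automorphism. -/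

import Mathlib

open MeasureTheory ProbabilityTheory

universe u v w

/-- The σ-algebra on probability mass functions generated by the evaluations `p ↦ p a`. For finite
`α` it is the Borel σ-algebra of the simplex `Δ(α) ⊆ [0,1]^α`. -/
instance PMF.instMeasurableSpaceEval {α : Type u} : MeasurableSpace (PMF α) :=
  MeasurableSpace.comap (fun p a => p a) MeasurableSpace.pi

theorem PMF.measurable_eval {α : Type u} (a : α) : Measurable (fun p : PMF α => p a) :=
  (measurable_pi_apply a).comp (comap_measurable (fun (p : PMF α) a => p a))

/-- The product of finitely many probability mass functions on finite types. -/
noncomputable def PMF.piFintype {ι : Type u} [Fintype ι] [DecidableEq ι] {α : ι → Type v}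
    [∀ i, Fintype (α i)] (p : ∀ i, PMF (α i)) : PMF (∀ i, α i) :=
  PMF.ofFintype (fun a => ∏ i, p i (a i)) (by
    have h := Finset.prod_univ_sum (fun i : ι => (Finset.univ : Finset (α i))) (fun i a => p i a)
    rw [Fintype.piFinset_univ] at h
    rw [← h]
    refine Finset.prod_eq_one fun i _ => ?_
    rw [← tsum_fintype (L := SummationFilter.unconditional _), (p i).tsum_coe])

/-- A finite-horizon decentralized partially observable Markov decision problem. -/
structure DecPOMDP where
  /-- the number of agents; the agents are the elements of `Fin N` -/
  N : ℕ
  N_pos : 0 < N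
  /-- states -/
  S : Type u
  fintypeS : Fintype S
  /-- actions of each agent -/
  A : Fin N → Type v
  fintypeA : ∀ i, Fintype (A i)
  /-- observations of each agent -/
  O : Fin N → Type w
  fintypeO : ∀ i, Fintype (O i)
  /-- transition kernel `P(· ∣ s, a)` -/
  trans : S → (∀ i, A i) → PMF S
  /-- joint reward function `R(s, a)` -/
  reward : S → (∀ i, A i) → ℝ
  /-- observation kernel `O(· ∣ s, a)`: `s` is the new state and `a` the previous joint action -/
  obs : S → (∀ i, A i) → PMF (∀ i, O i)
  /-- initial state distribution -/
  b₀ : PMF S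
  /-- horizon; the time steps are `0, …, T` -/
  T : ℕ

namespace DecPOMDP

attribute [instance] DecPOMDP.fintypeS DecPOMDP.fintypeA DecPOMDP.fintypeO

variable (D : DecPOMDP.{u, v, w})

abbrev Agent : Type := Fin D.N

abbrev JointAction : Type v := ∀ i, D.A i

abbrev JointObs : Type w := ∀ i, D.O i

/-- Local action-observation histories of agent `i` of length `t`; entry `k` is the pair
`(a_{i,k}, o_{i,k+1})`. -/
abbrev LocalHist (i : D.Agent) (t : ℕ) : Type (max v w) := Fin t → D.A i × D.O i

/-- Local stochastic policies of agent `i`, defined on the local histories of length `t ≤ T`. -/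
abbrev LocalPolicy (i : D.Agent) : Type (max v w) :=
  ∀ t : Fin (D.T + 1), D.LocalHist i t → PMF (D.A i)

/-- Joint stochastic policies. -/
abbrev Policy : Type (max v w) := ∀ i, D.LocalPolicy i

/-! ### The process induced by a joint policy -/

/-- Histories up to step `t`: states `s_0, …, s_t`, joint actions `a_0, …, a_t`, and joint
observations `o_1, …, o_t` (`o_{k+1}` has index `k`). Rewards are functions of states and actions. -/
abbrev Hist (t : ℕ) : Type (max u v w) :=
  (Fin (t + 1) → D.S) × (Fin (t + 1) → D.JointAction) × (Fin t → D.JointObs)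

/-- The law of the history `H_t` under the joint policy `π`, by sampling
`S_0 ∼ b₀`, `A_{i,0} ∼ π_i(· ∣ ∅)`, `S_{t+1} ∼ P(· ∣ S_t, A_t)`, `O_{t+1} ∼ O(· ∣ S_{t+1}, A_t)`,
`A_{i,t+1} ∼ π_i(· ∣ A_{i,0}, O_{i,1}, …, A_{i,t}, O_{i,t+1})`, independently over the agents. -/
noncomputable def histLaw (π : D.Policy) : (t : ℕ) → t < D.T + 1 → PMF (D.Hist t)
  | 0, h =>
    D.b₀.bind fun s =>
      (PMF.piFintype fun i => π i ⟨0, h⟩ Fin.elim0).bind fun a =>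
        PMF.pure (fun _ => s, fun _ => a, Fin.elim0)
  | t + 1, h =>
    (histLaw π t (Nat.lt_of_succ_lt h)).bind fun τ =>
      (D.trans (τ.1 (Fin.last t)) (τ.2.1 (Fin.last t))).bind fun s =>
        (D.obs s (τ.2.1 (Fin.last t))).bind fun o =>
          (PMF.piFintype fun i => π i ⟨t + 1, h⟩ fun k =>
              (τ.2.1 k i, (Fin.snoc τ.2.2 o : Fin (t + 1) → D.JointObs) k i)).bind fun a =>
            PMF.pure (Fin.snoc τ.1 s, Fin.snoc τ.2.1 a, Fin.snoc τ.2.2 o)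

/-- Complete histories (episodes); this is the sample space `Ω`, with all subsets measurable. -/
def History : Type (max u v w) := D.Hist D.T

noncomputable instance : Fintype D.History := inferInstanceAs (Fintype (D.Hist D.T))

instance : MeasurableSpace D.History := ⊤

/-- The distribution `ℙ_π` of the episode under the joint policy `π`. -/
noncomputable def law (π : D.Policy) : PMF D.History := D.histLaw π D.T (Nat.lt_succ_self _)

variable {D}

/-- The random variable `S_t`. -/
def History.state (τ : D.History) (t : Fin (D.T + 1)) : D.S := τ.1 t

/-- The random variable `A_t`. -/
def History.action (τ : D.History) (t : Fin (D.T + 1)) : D.JointAction := τ.2.1 t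

/-- The random variable `O_{k+1}`. -/
def History.observation (τ : D.History) (k : Fin D.T) : D.JointObs := τ.2.2 k

/-- The action-observation history of agent `i` at step `t`,
`(A_{i,0}, O_{i,1}, …, A_{i,t-1}, O_{i,t})`. -/
def History.localHist (τ : D.History) (i : D.Agent) (t : Fin (D.T + 1)) : D.LocalHist i t :=
  fun k => (τ.action ⟨k, k.2.trans t.2⟩ i, τ.observation ⟨k, by omega⟩ i)

/-- The return `∑_{t=0}^T R_t`. -/
noncomputable def History.totalReward (τ : D.History) : ℝ :=
  ∑ t : Fin (D.T + 1), D.reward (τ.state t) (τ.action t)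

variable (D)

/-- The self-play objective: the expected return of a joint policy. -/
noncomputable def J (π : D.Policy) : ℝ := ∫ τ, τ.totalReward ∂(D.law π).toMeasure

/-! ### Automorphisms -/

/-- Automorphisms of a Dec-POMDP. `Equiv.piCongr` gives the induced bijection on joint actions,
`(f a)_{f i} = f_{A_i} a_i`, and likewise on joint observations. -/
structure Aut where
  onAgent : D.Agent ≃ D.Agent
  onState : D.S ≃ D.S
  onAction : ∀ i, D.A i ≃ D.A (onAgent i)
  onObs : ∀ i, D.O i ≃ D.O (onAgent i)
  trans_eq : ∀ (s s' : D.S) (a : D.JointAction),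
    D.trans s a s' = D.trans (onState s) (onAgent.piCongr onAction a) (onState s')
  obs_eq : ∀ (s : D.S) (a : D.JointAction) (o : D.JointObs),
    D.obs s a o = D.obs (onState s) (onAgent.piCongr onAction a) (onAgent.piCongr onObs o)
  reward_eq : ∀ (s : D.S) (a : D.JointAction),
    D.reward s a = D.reward (onState s) (onAgent.piCongr onAction a)
  b₀_eq : ∀ s : D.S, D.b₀ s = D.b₀ (onState s)

/-- The identity automorphism. -/
instance : Nonempty D.Aut :=
  ⟨{ onAgent := Equiv.refl _
     onState := Equiv.refl _
     onAction := fun _ => Equiv.refl _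
     onObs := fun _ => Equiv.refl _
     trans_eq := fun _ _ _ => rfl
     obs_eq := fun _ _ _ => rfl
     reward_eq := fun _ _ => rfl
     b₀_eq := fun _ => rfl }⟩

instance : Finite D.Aut :=
  Finite.of_injective
    (β := Σ e : D.Agent ≃ D.Agent,
      (D.S ≃ D.S) × (∀ i, D.A i ≃ D.A (e i)) × (∀ i, D.O i ≃ D.O (e i)))
    (fun f => ⟨f.onAgent, f.onState, f.onAction, f.onObs⟩) (by
      rintro ⟨a, b, c, d, _, _, _, _⟩ ⟨a', b', c', d', _, _, _, _⟩ h
      obtain ⟨rfl, h⟩ := Sigma.mk.inj_iff.mp h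
      have h := eq_of_heq h
      simp only [Prod.mk.injEq] at h
      obtain ⟨rfl, rfl, rfl⟩ := h
      rfl)

noncomputable instance : Fintype D.Aut := Fintype.ofFinite _

variable {D}

/-- Transport of a local policy of agent `i` to agent `f i`:
`(a ∣ τ) ↦ σ(f⁻¹ a ∣ f⁻¹ τ)`, where `f⁻¹` acts on local histories elementwise. -/
noncomputable def Aut.pushLocal (f : D.Aut) (i : D.Agent) (σ : D.LocalPolicy i) :
    D.LocalPolicy (f.onAgent i) :=
  fun t h => (σ t fun k => ((f.onAction i).symm (h k).1, (f.onObs i).symm (h k).2)).map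
    (f.onAction i)

/-- The pushforward policy `f^*π`, given by `(f^*π)_{f i}(f a ∣ f τ) = π_i(a ∣ τ)`, that is,
`(f^*π)_i(a ∣ τ) = π_{f⁻¹ i}(f⁻¹ a ∣ f⁻¹ τ)`. -/
noncomputable def Aut.push (f : D.Aut) (π : D.Policy) : D.Policy :=
  Equiv.piCongrLeft D.LocalPolicy f.onAgent fun i => f.pushLocal i (π i)

theorem Aut.push_apply (f : D.Aut) (π : D.Policy) (i : D.Agent) (t : Fin (D.T + 1))
    (h : D.LocalHist i t) (a : D.A i) :
    f.push π (f.onAgent i) t (fun k => (f.onAction i (h k).1, f.onObs i (h k).2))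
      (f.onAction i a) = π i t h a := by
  classical
  rw [Aut.push, Equiv.piCongrLeft_apply_apply, Aut.pushLocal, PMF.map_apply]
  simp

/-- A policy is invariant to automorphism if `f^*π = π` for every automorphism `f`. -/
def IsInvariant (π : D.Policy) : Prop := ∀ f : D.Aut, f.push π = π

/-- For a profile `g` of automorphisms, agent `i` in `g^*π` uses the local policy of agent `i` in
`(g_i)^*π`. -/
noncomputable def pushProfile (g : D.Agent → D.Aut) (π : D.Policy) : D.Policy :=
  fun i => (g i).push π i

variable (D)

/-- The other-play objective: the expectation of `J (g^*π)` over a uniformly distributed profile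
of automorphisms. -/
noncomputable def JOP (π : D.Policy) : ℝ :=
  (∑ g : D.Agent → D.Aut, D.J (pushProfile g π)) / Fintype.card (D.Agent → D.Aut)

/-- Maximizers of the other-play objective. -/
def IsOPOptimal (π : D.Policy) : Prop := ∀ π' : D.Policy, D.JOP π' ≤ D.JOP π

/-! ### Policies corresponding to distributions over policies -/

theorem measurable_histLaw (t : ℕ) (ht : t < D.T + 1) (τ : D.Hist t) :
    Measurable fun π : D.Policy => D.histLaw π t ht τ := by
  classical
  have key : ∀ (t : Fin (D.T + 1)) (h : ∀ i, D.LocalHist i t) (a : D.JointAction),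
      Measurable fun π : D.Policy => PMF.piFintype (fun i => π i t (h i)) a := by
    intro t h a
    simp only [PMF.piFintype, PMF.ofFintype_apply]
    refine Finset.measurable_prod _ fun i _ => ?_
    refine (PMF.measurable_eval (a i)).comp ?_
    exact (measurable_pi_apply (h i)).comp ((measurable_pi_apply t).comp (measurable_pi_apply i))
  induction t with
  | zero =>
    simp only [histLaw, PMF.bind_apply, tsum_fintype]
    refine Finset.measurable_sum _ fun s _ => measurable_const.mul ?_
    refine Finset.measurable_sum _ fun a _ => Measurable.mul ?_ measurable_const
    exact key ⟨0, ht⟩ _ a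
  | succ t ih =>
    simp only [histLaw, PMF.bind_apply, tsum_fintype]
    refine Finset.measurable_sum _ fun τ' _ => (ih _ τ').mul ?_
    refine Finset.measurable_sum _ fun s _ => measurable_const.mul ?_
    refine Finset.measurable_sum _ fun o _ => measurable_const.mul ?_
    refine Finset.measurable_sum _ fun a _ => Measurable.mul ?_ measurable_const
    exact key ⟨t + 1, ht⟩ _ a

/-- The Markov kernel `π ↦ ℙ_π` from joint policies to episodes. -/
noncomputable def episodeKernel : Kernel D.Policy D.History where
  toFun π := (D.law π).toMeasure
  measurable' := by
    refine Measure.measurable_of_measurable_coe _ fun s hs => ?_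
    simp only [PMF.toMeasure_apply_fintype _ s]
    refine Finset.measurable_sum _ fun τ _ => ?_
    by_cases h : τ ∈ s
    · simp only [Set.indicator_of_mem h]
      exact D.measurable_histLaw D.T (Nat.lt_succ_self _) τ
    · simp [h]

instance : IsMarkovKernel D.episodeKernel :=
  ⟨fun π => inferInstanceAs (IsProbabilityMeasure (D.law π).toMeasure)⟩

/-- The measure `ℙ_μ` on `Π × Ω`: a joint policy is drawn from `μ` and an episode is played with
it, i.e. `ℙ_μ(Z × Q) = 𝔼_{π ∼ μ}[1_Z(π) ℙ_π(Q)]`. -/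
noncomputable def mixLaw (μ : ProbabilityMeasure D.Policy) : Measure (D.Policy × D.History) :=
  (μ : Measure D.Policy) ⊗ₘ D.episodeKernel

instance (μ : ProbabilityMeasure D.Policy) : IsProbabilityMeasure (D.mixLaw μ) :=
  inferInstanceAs (IsProbabilityMeasure ((μ : Measure D.Policy) ⊗ₘ D.episodeKernel))

variable {D}

/-- The distribution `μ_i ⊗ μ_{-i}` over joint policies, where `μ_{-i} = ⨂_{j ≠ i} ν_j` has
independent local policies (the component `ν_i` is not used). -/
noncomputable def withOpponents (i : D.Agent) (μi : ProbabilityMeasure (D.LocalPolicy i))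
    (ν : ∀ j, ProbabilityMeasure (D.LocalPolicy j)) : ProbabilityMeasure D.Policy :=
  ⟨Measure.pi fun j => (Function.update ν i μi j : Measure (D.LocalPolicy j)), inferInstance⟩

/-- The event that the action-observation history of agent `i` at step `t` is `h`. -/
def histEvent (i : D.Agent) (t : Fin (D.T + 1)) (h : D.LocalHist i t) :
    Set (D.Policy × D.History) := {x | x.2.localHist i t = h}

/-- The event that agent `i` plays `a` at step `t`. -/
def actionEvent (i : D.Agent) (t : Fin (D.T + 1)) (a : D.A i) :
    Set (D.Policy × D.History) := {x | x.2.action t i = a}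

theorem sum_cond_actionEvent (μ : ProbabilityMeasure D.Policy) (i : D.Agent)
    (t : Fin (D.T + 1)) (h : D.LocalHist i t) (hh : D.mixLaw μ (histEvent i t h) ≠ 0) :
    ∑ a, (D.mixLaw μ)[actionEvent i t a | histEvent i t h] = 1 := by
  have := cond_isProbabilityMeasure hh
  have hm : ∀ a, MeasurableSet (actionEvent (D := D) i t a) := fun a =>
    measurable_snd (t := {τ : D.History | τ.action t i = a}) trivial
  have hsum := sum_measure_preimage_singleton (μ := (D.mixLaw μ)[|histEvent i t h])
    (Finset.univ : Finset (D.A i)) (f := fun x : D.Policy × D.History => x.2.action t i)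
    (fun a _ => hm a)
  refine Eq.trans hsum ?_
  simp

theorem nonempty_action (i : D.Agent) (μi : ProbabilityMeasure (D.LocalPolicy i)) :
    Nonempty (D.A i) := by
  obtain ⟨σ⟩ := μi.nonempty
  exact ⟨(σ 0 Fin.elim0).support_nonempty.some⟩

open Classical in
/-- The local policy corresponding to a distribution `μ_i` over local policies of agent `i`: the
conditional probability `ℙ_{μ_i ⊗ μ_{-i}}(A_{i,t} = a ∣ AO_{i,t} = h)`, for some `μ_{-i}` with
independent local policies under which `h` has positive probability, and the uniform distribution
if there is no such `μ_{-i}`. -/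
noncomputable def behaviourLocal (i : D.Agent) (μi : ProbabilityMeasure (D.LocalPolicy i)) :
    D.LocalPolicy i := fun t h =>
  if hex : ∃ ν, D.mixLaw (withOpponents i μi ν) (histEvent i t h) ≠ 0 then
    PMF.ofFintype
      (fun a => (D.mixLaw (withOpponents i μi hex.choose))[actionEvent i t a | histEvent i t h])
      (sum_cond_actionEvent _ i t h hex.choose_spec)
  else
    haveI := nonempty_action i μi
    PMF.uniformOfFintype (D.A i)

/-- The marginal `μ_i` of a distribution over joint policies. -/
noncomputable def marginal (μ : ProbabilityMeasure D.Policy) (i : D.Agent) :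
    ProbabilityMeasure (D.LocalPolicy i) :=
  μ.map (f := fun π => π i) (measurable_pi_apply i).aemeasurable

/-- The joint policy `π^μ` corresponding to a distribution over joint policies. -/
noncomputable def behaviour (μ : ProbabilityMeasure D.Policy) : D.Policy :=
  fun i => behaviourLocal i (marginal μ i)

/-- `ρ` is the joint policy corresponding to `μ`, whichever opponent distributions are used to
compute the conditional probabilities. -/
def Corresponds (μ : ProbabilityMeasure D.Policy) (ρ : D.Policy) : Prop :=
  ∀ (i : D.Agent) (t : Fin (D.T + 1)) (h : D.LocalHist i t),
    (∀ ν, D.mixLaw (withOpponents i (marginal μ i) ν) (histEvent i t h) ≠ 0 →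
      ∀ a, ρ i t h a =
        (D.mixLaw (withOpponents i (marginal μ i) ν))[actionEvent i t a | histEvent i t h]) ∧
    ((∀ ν, D.mixLaw (withOpponents i (marginal μ i) ν) (histEvent i t h) = 0) →
      ∀ a, ρ i t h a = (Fintype.card (D.A i) : ENNReal)⁻¹)

/-! ### The other-play distribution and the symmetrizer -/

/-- The other-play distribution `|Aut(D)|^{-N} ∑_g δ_{g^*π}` of a joint policy. -/
noncomputable def opDist (π : D.Policy) : ProbabilityMeasure D.Policy :=
  ⟨((Fintype.card D.Aut : ENNReal) ^ D.N)⁻¹ •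
      ∑ g : D.Agent → D.Aut, Measure.dirac (pushProfile g π), ⟨by
    have h0 : (Fintype.card D.Aut : ENNReal) ≠ 0 := by simp
    simp only [Measure.smul_apply, Measure.coe_finsetSum, Finset.sum_apply, measure_univ,
      Finset.sum_const, Finset.card_univ, Fintype.card_pi, Finset.prod_const, Fintype.card_fin,
      smul_eq_mul, nsmul_eq_mul, mul_one, Nat.cast_pow]
    exact ENNReal.inv_mul_cancel (pow_ne_zero _ h0) (ENNReal.pow_ne_top (by simp))⟩⟩

/-- The symmetrizer `Ψ`. -/
noncomputable def symmetrizer (π : D.Policy) : D.Policy := behaviour (opDist π)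

variable (D)

/-- Two joint policies are equivalent if they have the same image under the symmetrizer. -/
noncomputable def opSetoid : Setoid D.Policy := Setoid.ker symmetrizer

end DecPOMDP

/-! The probability of an episode under `π` is an environment factor times one factor per agent, the
product of the probabilities with which `π i` chose its actions (`histLaw_apply`, `law_apply`).
Everything follows from this factorization, in the manner of Kuhn's theorem on mixed and behavioural
strategies.

Well-definedness: if agent `i` draws its local policy from `m`, independently of its opponents, then
the probability of a local history, with or without the next action, is a mean over `m` times the
same factor `oppWeight` (`mixLaw_withOpponents`). The conditional probability is a quotient in which
that factor cancels, so the opponents only decide whether it is defined.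

Value: multiplying these conditional probabilities along a history telescopes, so the path weight of
the corresponding local policy is the mean path weight, on every history that the environment can
produce (`pathWeight_behaviourLocal`). The entries of a uniform profile of automorphisms are
independent, so the product over agents of the means is the mean over profiles of the products.
Hence the law of `symmetrizer π` is the average of the laws of the policies `pushProfile g π`
(`law_symmetrizer_apply`), and the expected return is linear in the law.

Invariance: composition with a fixed `f` permutes the finite set of automorphisms, so the means for
agent `i` at `h` and for agent `f i` at `f h` agree; `f` also preserves which histories the
environment can produce, so the uniform default is used at corresponding places. On an invariant
policy `JOP` and `J` coincide, so symmetrizing preserves `JOP` and carries maximizers to invariant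
maximizers. -/

/-! ### Integrals and sums over finite products. -/

/-- The integral of a product of functions of the single coordinates against a product of
probability measures. -/
theorem lintegral_pi_prod_apply {ι : Type*} [Fintype ι] {X : ι → Type*}
    [∀ i, MeasurableSpace (X i)] (m : ∀ i, Measure (X i)) [∀ i, IsProbabilityMeasure (m i)]
    (F : ∀ i, X i → ENNReal) (hF : ∀ i, Measurable (F i)) :
    ∫⁻ x, ∏ i, F i (x i) ∂(Measure.pi m) = ∏ i, ∫⁻ y, F i y ∂(m i) := by
  have hind : iIndepFun (fun i (x : ∀ i, X i) => F i (x i)) (Measure.pi m) :=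
    iIndepFun_pi fun i => (hF i).aemeasurable
  have h := lintegral_prod_eq_prod_lintegral_of_indepFun Finset.univ
    (fun i (x : ∀ i, X i) => F i (x i)) hind (fun i => (hF i).comp (measurable_pi_apply i))
  rw [h]
  refine Finset.prod_congr rfl fun i _ => ?_
  exact (measurePreserving_eval m i).lintegral_comp (hF i)

/-- Integrating out one coordinate of a product. -/
theorem lintegral_pi_mul_prod_erase {ι : Type*} [Fintype ι] [DecidableEq ι] {X : ι → Type*}
    [∀ i, MeasurableSpace (X i)] (m : ∀ i, Measure (X i)) [∀ i, IsProbabilityMeasure (m i)]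
    (i : ι) (G : X i → ENNReal) (hG : Measurable G)
    (F : ∀ i, X i → ENNReal) (hF : ∀ i, Measurable (F i)) :
    ∫⁻ x, G (x i) * ∏ j ∈ Finset.univ.erase i, F j (x j) ∂(Measure.pi m) =
      (∫⁻ y, G y ∂(m i)) * ∏ j ∈ Finset.univ.erase i, ∫⁻ y, F j y ∂(m j) := by
  have h := lintegral_pi_prod_apply m (Function.update F i G) (fun j => by
    by_cases hj : j = i
    · subst hj; simpa using hG
    · simpa [hj] using hF j)
  simp_rw [← Finset.mul_prod_erase Finset.univ _ (Finset.mem_univ i), Function.update_self] at h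
  have e1 : ∀ x : ∀ i, X i, ∏ j ∈ Finset.univ.erase i, Function.update F i G j (x j) =
      ∏ j ∈ Finset.univ.erase i, F j (x j) := fun x =>
    Finset.prod_congr rfl fun j hj => by rw [Function.update_of_ne (Finset.ne_of_mem_erase hj)]
  have e2 : ∏ j ∈ Finset.univ.erase i, ∫⁻ y, Function.update F i G j y ∂(m j) =
      ∏ j ∈ Finset.univ.erase i, ∫⁻ y, F j y ∂(m j) :=
    Finset.prod_congr rfl fun j hj => by rw [Function.update_of_ne (Finset.ne_of_mem_erase hj)]
  simp_rw [e1] at h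
  rw [h, e2]

theorem PMF.sum_univ_eq_one {α : Type*} [Fintype α] (p : PMF α) : ∑ a, p a = 1 := by
  rw [← tsum_fintype (L := SummationFilter.unconditional _), p.tsum_coe]

theorem PMF.piFintype_apply {ι : Type u} [Fintype ι] [DecidableEq ι] {α : ι → Type v}
    [∀ i, Fintype (α i)] (p : ∀ i, PMF (α i)) (a : ∀ i, α i) :
    PMF.piFintype p a = ∏ i, p i (a i) := rfl

open Classical in
/-- The marginals of a product of probability mass functions. -/
theorem PMF.sum_piFintype_ite {ι : Type u} [Fintype ι] [DecidableEq ι] {α : ι → Type v}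
    [∀ i, Fintype (α i)] (p : ∀ i, PMF (α i)) (i : ι) (B : Set (α i)) :
    ∑ a : ∀ i, α i, (if a i ∈ B then PMF.piFintype p a else 0) =
      ∑ b, if b ∈ B then p i b else 0 := by
  -- The indicator of `B` is absorbed into the `i`-th factor; the other factors then sum to one.
  let F : ∀ j, α j → ENNReal :=
    Function.update (fun j x => p j x) i (fun b => if b ∈ B then p i b else 0)
  have hF : ∀ a : ∀ i, α i, (if a i ∈ B then PMF.piFintype p a else 0) = ∏ j, F j (a j) := by
    intro a
    rw [PMF.piFintype_apply, ← Finset.mul_prod_erase Finset.univ _ (Finset.mem_univ i),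
      ← Finset.mul_prod_erase Finset.univ (fun j => F j (a j)) (Finset.mem_univ i)]
    have : ∏ j ∈ Finset.univ.erase i, F j (a j) = ∏ j ∈ Finset.univ.erase i, p j (a j) :=
      Finset.prod_congr rfl fun j hj => by
        simp only [F]; rw [Function.update_of_ne (Finset.ne_of_mem_erase hj)]
    rw [this]
    simp only [F, Function.update_self, ite_mul, zero_mul]
  have h := Finset.prod_univ_sum (fun i : ι => (Finset.univ : Finset (α i))) F
  rw [Fintype.piFinset_univ] at h
  simp_rw [hF]
  rw [← h, ← Finset.mul_prod_erase Finset.univ _ (Finset.mem_univ i), Finset.prod_eq_one, mul_one]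
  · simp only [F, Function.update_self]
  · intro j hj
    simp only [F]
    rw [Function.update_of_ne (Finset.ne_of_mem_erase hj)]
    exact (p j).sum_univ_eq_one

namespace DecPOMDP

variable {D : DecPOMDP.{u, v, w}}

/-! ### Factorization of the law of histories -/

variable (D) in
/-- Histories up to step `t` without the last joint action. -/
abbrev PreHist (t : ℕ) : Type (max u v w) :=
  (Fin (t + 1) → D.S) × (Fin t → D.JointAction) × (Fin t → D.JointObs)

/-- The local history of an agent. -/
def PreHist.toLocal {t : ℕ} (x : D.PreHist t) (i : D.Agent) : D.LocalHist i t :=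
  fun k => (x.2.1 k i, x.2.2 k i)

/-- The contribution of the environment to the probability of a history. -/
noncomputable def PreHist.envWeight {t : ℕ} (x : D.PreHist t) : ENNReal :=
  D.b₀ (x.1 0) * ∏ k : Fin t,
    (D.trans (x.1 k.castSucc) (x.2.1 k) (x.1 k.succ) * D.obs (x.1 k.succ) (x.2.1 k) (x.2.2 k))

/-- Forget the last joint action. -/
def dropLast {t : ℕ} (τ : D.Hist t) : D.PreHist t := (τ.1, fun k => τ.2.1 k.castSucc, τ.2.2)

/-- The product of the probabilities with which a local policy chooses the actions of a local
history. -/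
noncomputable def pathWeight {i : D.Agent} (σ : D.LocalPolicy i) (t : ℕ) (ht : t < D.T + 1)
    (h : D.LocalHist i t) : ENNReal :=
  ∏ k : Fin t, σ ⟨k, k.2.trans ht⟩ (fun j => h ⟨j, j.2.trans k.2⟩) (h k).1

theorem pathWeight_snoc {i : D.Agent} (σ : D.LocalPolicy i) (t : ℕ) (ht : t + 1 < D.T + 1)
    (h : D.LocalHist i (t + 1)) :
    pathWeight σ (t + 1) ht h =
      pathWeight σ t (Nat.lt_of_succ_lt ht) (fun k => h k.castSucc) *
        σ ⟨t, Nat.lt_of_succ_lt ht⟩ (fun k => h k.castSucc) (h (Fin.last t)).1 := by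
  rw [pathWeight, Fin.prod_univ_castSucc]
  rfl

theorem measurable_localPolicy_apply {i : D.Agent} (t : Fin (D.T + 1)) (h : D.LocalHist i t)
    (a : D.A i) : Measurable fun σ : D.LocalPolicy i => σ t h a :=
  (PMF.measurable_eval a).comp ((measurable_pi_apply h).comp (measurable_pi_apply t))

theorem measurable_pathWeight {i : D.Agent} (t : ℕ) (ht : t < D.T + 1) (h : D.LocalHist i t) :
    Measurable fun σ : D.LocalPolicy i => pathWeight σ t ht h :=
  Finset.measurable_prod _ fun _ _ => measurable_localPolicy_apply _ _ _

theorem pathWeight_le_one {i : D.Agent} (σ : D.LocalPolicy i) (t : ℕ) (ht : t < D.T + 1)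
    (h : D.LocalHist i t) : pathWeight σ t ht h ≤ 1 :=
  Finset.prod_le_one' fun _ _ => PMF.coe_le_one _ _

theorem envWeight_ne_top {t : ℕ} (x : D.PreHist t) : x.envWeight ≠ ⊤ :=
  ENNReal.mul_ne_top (PMF.apply_ne_top _ _) (ENNReal.prod_ne_top fun _ _ =>
    ENNReal.mul_ne_top (PMF.apply_ne_top _ _) (PMF.apply_ne_top _ _))

/-- `Fin.snoc` is injective in both arguments, so exactly one term of each nested sum survives. -/
theorem histLaw_succ_snoc (π : D.Policy) (t : ℕ) (ht : t + 1 < D.T + 1) (τ : D.Hist t)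
    (s : D.S) (a : D.JointAction) (o : D.JointObs) :
    D.histLaw π (t + 1) ht
        ((Fin.snoc τ.1 s, Fin.snoc τ.2.1 a, Fin.snoc τ.2.2 o) : D.Hist (t + 1)) =
      D.histLaw π t (Nat.lt_of_succ_lt ht) τ *
        (D.trans (τ.1 (Fin.last t)) (τ.2.1 (Fin.last t)) s *
          (D.obs s (τ.2.1 (Fin.last t)) o *
            ∏ i, π i ⟨t + 1, ht⟩ (fun k =>
              (τ.2.1 k i, (Fin.snoc τ.2.2 o : Fin (t + 1) → D.JointObs) k i)) (a i))) := by
  obtain ⟨τ1, τ2, τ3⟩ := τ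
  rw [histLaw, PMF.bind_apply, tsum_eq_single (τ1, τ2, τ3)]
  · rw [PMF.bind_apply, tsum_eq_single s]
    · rw [PMF.bind_apply, tsum_eq_single o]
      · rw [PMF.bind_apply, tsum_eq_single a]
        · simp [PMF.piFintype_apply]
        · intro a' ha'
          simp [PMF.pure_apply, Fin.snoc_inj, ha'.symm]
      · intro o' ho'
        simp [PMF.bind_apply, PMF.pure_apply, Fin.snoc_inj, ho'.symm]
    · intro s' hs'
      simp [PMF.bind_apply, PMF.pure_apply, Fin.snoc_inj, hs'.symm]
  · rintro ⟨τ1', τ2', τ3'⟩ h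
    have : ¬ (τ1 = τ1' ∧ τ2 = τ2' ∧ τ3 = τ3') := by
      rintro ⟨rfl, rfl, rfl⟩; exact h rfl
    refine mul_eq_zero_of_right _ ?_
    simp only [PMF.bind_apply, PMF.pure_apply, Prod.mk.injEq, Fin.snoc_inj]
    simp only [ENNReal.tsum_eq_zero, mul_eq_zero, ite_eq_right_iff]
    intros
    right; intros; right; intros; right
    intro hh
    obtain ⟨h1, h2⟩ := Prod.mk.inj hh
    obtain ⟨h2, h3⟩ := Prod.mk.inj h2
    exact absurd ⟨(Fin.snoc_inj.mp h1).1, (Fin.snoc_inj.mp h2).1, (Fin.snoc_inj.mp h3).1⟩ this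

/-- The last joint action is kept apart from the path weights, which cover the steps before `t`; in
the induction the former last action moves into them. -/
theorem histLaw_apply (π : D.Policy) (t : ℕ) (ht : t < D.T + 1) (τ : D.Hist t) :
    D.histLaw π t ht τ = (dropLast τ).envWeight *
      ((∏ i, pathWeight (π i) t ht ((dropLast τ).toLocal i)) *
        PMF.piFintype (fun i => π i ⟨t, ht⟩ ((dropLast τ).toLocal i)) (τ.2.1 (Fin.last t))) := by
  induction t with
  | zero =>
    obtain ⟨s, a, o⟩ := τ
    have hs : s = fun _ => s 0 := by funext k; rw [Fin.fin_one_eq_zero k]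
    have ha : a = fun _ => a 0 := by funext k; rw [Fin.fin_one_eq_zero k]
    rw [histLaw, PMF.bind_apply, tsum_eq_single (s 0)]
    · rw [PMF.bind_apply, tsum_eq_single (a 0)]
      · rw [PMF.pure_apply, if_pos, mul_one, PreHist.envWeight]
        · simp only [pathWeight, Finset.univ_eq_empty, Finset.prod_empty, mul_one,
            Finset.prod_const_one, one_mul]
          congr
          funext i
          congr
          funext k
          exact k.elim0
        · rw [← hs, ← ha]
          congr
          exact Subsingleton.elim _ _
      · intro a' h
        rw [PMF.pure_apply, if_neg, mul_zero]
        intro h'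
        simp only [Prod.mk.injEq] at h'
        exact h (congrFun h'.2.1 0).symm
    · intro s' h
      refine mul_eq_zero_of_right _ ?_
      simp only [PMF.bind_apply, PMF.pure_apply, Prod.mk.injEq, ENNReal.tsum_eq_zero]
      intro a'
      rw [if_neg, mul_zero]
      intro h'
      exact h (congrFun (Prod.mk.inj h').1 0).symm
  | succ t ih =>
    obtain ⟨s, a, o⟩ := τ
    have h := histLaw_succ_snoc π t ht
      (fun k => s k.castSucc, fun k => a k.castSucc, fun k => o k.castSucc)
      (s (Fin.last _)) (a (Fin.last _)) (o (Fin.last _))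
    have hs : (Fin.snoc (fun k => s k.castSucc) (s (Fin.last _)) : Fin (t + 1 + 1) → D.S) = s :=
      Fin.snoc_init_self s
    have ha : (Fin.snoc (fun k => a k.castSucc) (a (Fin.last _)) :
        Fin (t + 1 + 1) → D.JointAction) = a := Fin.snoc_init_self a
    have ho : (Fin.snoc (fun k => o k.castSucc) (o (Fin.last _)) : Fin (t + 1) → D.JointObs) = o :=
      Fin.snoc_init_self o
    simp only [hs, ha, ho] at h
    rw [h, ih]
    simp only [PreHist.envWeight, Fin.prod_univ_castSucc (n := t), pathWeight_snoc,
      Finset.prod_mul_distrib, PMF.piFintype_apply]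
    simp only [dropLast, PreHist.toLocal, Fin.succ_last, Fin.castSucc_zero]
    have key : ∀ b p w q c d r : ENNReal,
        b * p * (w * q) * (c * (d * r)) = b * (p * (c * d)) * (w * q * r) := by intros; ring
    exact key _ _ _ _ _ _ _

/-- The restriction of a history to the steps up to `t`. -/
def truncate {t n : ℕ} (h : t ≤ n) (τ : D.Hist n) : D.Hist t :=
  (fun k => τ.1 (k.castLE (Nat.succ_le_succ h)), fun k => τ.2.1 (k.castLE (Nat.succ_le_succ h)),
    fun k => τ.2.2 (k.castLE h))

/-- Truncation does not see the last step, whose sampling kernels have total mass one and so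
integrate out. -/
theorem histLaw_map_truncate (π : D.Policy) {t n : ℕ} (h : t ≤ n) (hn : n < D.T + 1) :
    (D.histLaw π n hn).map (truncate h) = D.histLaw π t (h.trans_lt hn) := by
  induction n with
  | zero =>
    obtain rfl := Nat.le_zero.mp h
    exact PMF.map_id _
  | succ n ih =>
    rcases Nat.lt_or_ge n t with h' | h'
    · obtain rfl : t = n + 1 := le_antisymm h h'
      exact PMF.map_id _
    · rw [← ih h' (Nat.lt_of_succ_lt hn), histLaw, PMF.map_bind, PMF.map]
      congr 1
      funext τ
      simp only [PMF.map_bind, PMF.pure_map]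
      have e : ∀ s o a, truncate (D := D) h (Fin.snoc τ.1 s, Fin.snoc τ.2.1 a, Fin.snoc τ.2.2 o) =
          truncate h' τ := by
        intro s o a
        simp only [truncate]
        refine Prod.ext ?_ (Prod.ext ?_ ?_) <;> funext k
        · exact Fin.snoc_castSucc (α := fun _ => D.S) _ _ (k.castLE (Nat.succ_le_succ h'))
        · exact Fin.snoc_castSucc (α := fun _ => D.JointAction) _ _
            (k.castLE (Nat.succ_le_succ h'))
        · exact Fin.snoc_castSucc (α := fun _ => D.JointObs) _ _ (k.castLE h')
      simp only [e, PMF.bind_const, Function.comp]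

/-- A history is a history without last joint action together with the last joint action. -/
def histEquiv (t : ℕ) : D.Hist t ≃ D.PreHist t × D.JointAction where
  toFun τ := (dropLast τ, τ.2.1 (Fin.last t))
  invFun x := (x.1.1, Fin.snoc x.1.2.1 x.2, x.1.2.2)
  left_inv τ := by
    obtain ⟨s, a, o⟩ := τ
    exact congrArg (fun a => (s, a, o)) (Fin.snoc_init_self a)
  right_inv x := by
    obtain ⟨⟨s, a, o⟩, a'⟩ := x
    simp [dropLast]

open Classical in
/-- The probability that agent `i` has the local history `h` and then plays an action in `B`. -/
theorem law_localHist_action (π : D.Policy) (i : D.Agent) (t : Fin (D.T + 1))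
    (h : D.LocalHist i t) (B : Set (D.A i)) :
    (D.law π).toMeasure {τ | τ.localHist i t = h ∧ τ.action t i ∈ B} =
      ∑ x : D.PreHist t, (if x.toLocal i = h then x.envWeight else 0) *
        ((pathWeight (π i) t t.2 h * ∑ b, if b ∈ B then π i t h b else 0) *
          ∏ j ∈ Finset.univ.erase i, pathWeight (π j) t t.2 (x.toLocal j)) := by
  -- The event depends only on the steps up to `t`, so the law of the truncated history suffices.
  have h1 : (D.law π).toMeasure {τ | τ.localHist i t = h ∧ τ.action t i ∈ B} =
      (D.histLaw π t t.2).toOuterMeasure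
        {τ | (dropLast τ).toLocal i = h ∧ τ.2.1 (Fin.last t) i ∈ B} := by
    rw [PMF.toMeasure_apply_eq_toOuterMeasure_apply _ MeasurableSpace.measurableSet_top,
      ← histLaw_map_truncate π (Nat.le_of_lt_succ t.2) (Nat.lt_succ_self _),
      PMF.toOuterMeasure_map_apply]
    rfl
  rw [h1, PMF.toOuterMeasure_apply_fintype, ← (histEquiv (D := D) t).symm.sum_comp,
    Fintype.sum_prod_type]
  refine Finset.sum_congr rfl fun x _ => ?_
  have h2 : ∀ a : D.JointAction, Set.indicator
      {τ : D.Hist t | (dropLast τ).toLocal i = h ∧ τ.2.1 (Fin.last t) i ∈ B}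
      (D.histLaw π t t.2) ((histEquiv (D := D) t).symm (x, a)) =
      ((if x.toLocal i = h then x.envWeight else 0) *
        ∏ j, pathWeight (π j) t t.2 (x.toLocal j)) *
        (if a i ∈ B then PMF.piFintype (fun j => π j t (x.toLocal j)) a else 0) := by
    intro a
    have e := (histEquiv (D := D) t).apply_symm_apply (x, a)
    have e1 : dropLast ((histEquiv (D := D) t).symm (x, a)) = x := congrArg Prod.fst e
    have e2 : ((histEquiv (D := D) t).symm (x, a)).2.1 (Fin.last t) = a := congrArg Prod.snd e
    rw [Set.indicator_apply, histLaw_apply]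
    simp only [Set.mem_ofPred_eq, e1, e2]
    by_cases hx : x.toLocal i = h <;> by_cases ha : a i ∈ B <;> simp [hx, ha, mul_assoc]
  simp_rw [h2]
  rw [← Finset.mul_sum, PMF.sum_piFintype_ite]
  by_cases hx : x.toLocal i = h
  · rw [← Finset.mul_prod_erase Finset.univ _ (Finset.mem_univ i), hx]
    ring
  · simp [hx]

/-! ### Mixtures with independent opponents. -/

/-- The total probability of a local history contributed by the environment and by opponents with
independent random local policies. -/
noncomputable def oppWeight (i : D.Agent) (ν : ∀ j, ProbabilityMeasure (D.LocalPolicy j))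
    (t : Fin (D.T + 1)) (h : D.LocalHist i t) : ENNReal :=
  open Classical in
  ∑ x : D.PreHist t, (if x.toLocal i = h then x.envWeight else 0) *
    ∏ j ∈ Finset.univ.erase i, ∫⁻ σ, pathWeight σ t t.2 (x.toLocal j) ∂(ν j : Measure _)

/-- The expected path weight of a random local policy. -/
noncomputable def meanWeight {i : D.Agent} (m : ProbabilityMeasure (D.LocalPolicy i))
    (t : Fin (D.T + 1)) (h : D.LocalHist i t) : ENNReal :=
  ∫⁻ σ, pathWeight σ t t.2 h ∂(m : Measure _)

/-- The expected weight of a local history followed by an action. -/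
noncomputable def meanActionWeight {i : D.Agent} (m : ProbabilityMeasure (D.LocalPolicy i))
    (t : Fin (D.T + 1)) (h : D.LocalHist i t) (a : D.A i) : ENNReal :=
  ∫⁻ σ, pathWeight σ t t.2 h * σ t h a ∂(m : Measure _)

-- For each history of the environment, independence splits the integral over the agents. Since the
-- local history of agent `i` is fixed to `h`, its factor is the same in all terms and comes out of
-- the sum.
open Classical in
theorem mixLaw_withOpponents (i : D.Agent) (m : ProbabilityMeasure (D.LocalPolicy i))
    (ν : ∀ j, ProbabilityMeasure (D.LocalPolicy j)) (t : Fin (D.T + 1)) (h : D.LocalHist i t)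
    (B : Set (D.A i)) :
    D.mixLaw (withOpponents i m ν) {x | x.2.localHist i t = h ∧ x.2.action t i ∈ B} =
      (∫⁻ σ, pathWeight σ t t.2 h * (∑ b, if b ∈ B then σ t h b else 0) ∂(m : Measure _)) *
        oppWeight i ν t h := by
  have hG : Measurable fun σ : D.LocalPolicy i =>
      pathWeight σ t t.2 h * (∑ b, if b ∈ B then σ t h b else 0) := by
    refine (measurable_pathWeight _ _ _).mul (Finset.measurable_sum _ fun b _ => ?_)
    by_cases hb : b ∈ B
    · simpa [hb] using measurable_localPolicy_apply t h b
    · simp [hb]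
  have hms : MeasurableSet
      {x : D.Policy × D.History | x.2.localHist i t = h ∧ x.2.action t i ∈ B} :=
    measurable_snd (t := {τ : D.History | τ.localHist i t = h ∧ τ.action t i ∈ B}) trivial
  rw [mixLaw, Measure.compProd_apply hms]
  have e : ∀ π : D.Policy, D.episodeKernel π
      (Prod.mk π ⁻¹' {x : D.Policy × D.History | x.2.localHist i t = h ∧ x.2.action t i ∈ B}) = _ :=
    fun π => law_localHist_action π i t h B
  simp_rw [e]
  rw [lintegral_finsetSum, oppWeight, Finset.mul_sum]
  · refine Finset.sum_congr rfl fun x _ => ?_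
    rw [lintegral_const_mul]
    · have hp := lintegral_pi_mul_prod_erase
        (fun j => (Function.update ν i m j : Measure (D.LocalPolicy j))) i _ hG
        (fun j σ => pathWeight σ t t.2 (x.toLocal j)) (fun j => measurable_pathWeight _ _ _)
      refine (congrArg _ hp).trans ?_
      rw [Function.update_self, mul_left_comm]
      congr 2
      refine Finset.prod_congr rfl fun j hj => ?_
      rw [Function.update_of_ne (Finset.ne_of_mem_erase hj)]
    · exact (hG.comp (measurable_pi_apply i)).mul (Finset.measurable_prod _ fun j _ =>
        (measurable_pathWeight _ t.2 _).comp (measurable_pi_apply j))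
  · intro x _
    exact measurable_const.mul ((hG.comp (measurable_pi_apply i)).mul
      (Finset.measurable_prod _ fun j _ =>
        (measurable_pathWeight _ t.2 _).comp (measurable_pi_apply j)))

theorem mixLaw_histEvent (i : D.Agent) (m : ProbabilityMeasure (D.LocalPolicy i))
    (ν : ∀ j, ProbabilityMeasure (D.LocalPolicy j)) (t : Fin (D.T + 1)) (h : D.LocalHist i t) :
    D.mixLaw (withOpponents i m ν) (histEvent i t h) = meanWeight m t h * oppWeight i ν t h := by
  have := mixLaw_withOpponents i m ν t h Set.univ
  simpa [PMF.sum_univ_eq_one, histEvent, meanWeight] using this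

theorem mixLaw_histEvent_inter_actionEvent (i : D.Agent)
    (m : ProbabilityMeasure (D.LocalPolicy i))
    (ν : ∀ j, ProbabilityMeasure (D.LocalPolicy j)) (t : Fin (D.T + 1)) (h : D.LocalHist i t)
    (a : D.A i) :
    D.mixLaw (withOpponents i m ν) (histEvent i t h ∩ actionEvent i t a) =
      meanActionWeight m t h a * oppWeight i ν t h := by
  have := mixLaw_withOpponents i m ν t h {a}
  refine this.trans (congrArg (· * _) (lintegral_congr fun σ => ?_))
  congr 1
  refine (Finset.sum_eq_single a (fun b _ hb => ?_) (by simp)).trans ?_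
  · exact if_neg (by simpa using hb)
  · exact if_pos (Set.mem_singleton a)

theorem measurableSet_histEvent (i : D.Agent) (t : Fin (D.T + 1)) (h : D.LocalHist i t) :
    MeasurableSet (histEvent (D := D) i t h) :=
  measurable_snd (t := {τ : D.History | τ.localHist i t = h}) trivial

theorem lintegral_pathWeight_le_one {i : D.Agent} (m : ProbabilityMeasure (D.LocalPolicy i))
    (t : ℕ) (ht : t < D.T + 1) (h : D.LocalHist i t) :
    ∫⁻ σ, pathWeight σ t ht h ∂(m : Measure _) ≤ 1 :=
  (lintegral_mono fun σ => pathWeight_le_one σ t ht h).trans (by simp)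

theorem oppWeight_ne_top (i : D.Agent) (ν : ∀ j, ProbabilityMeasure (D.LocalPolicy j))
    (t : Fin (D.T + 1)) (h : D.LocalHist i t) : oppWeight i ν t h ≠ ⊤ := by
  classical
  rw [oppWeight]
  refine ENNReal.sum_ne_top.mpr fun x _ => ENNReal.mul_ne_top ?_ (ENNReal.prod_ne_top fun j _ =>
    ne_top_of_le_ne_top ENNReal.one_ne_top (lintegral_pathWeight_le_one _ _ _ _))
  split_ifs
  · exact envWeight_ne_top x
  · simp

/-- The factor `oppWeight` cancels, being finite and, by `hh`, nonzero; the right side no longer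
involves `ν`. -/
theorem cond_actionEvent (i : D.Agent) (m : ProbabilityMeasure (D.LocalPolicy i))
    (ν : ∀ j, ProbabilityMeasure (D.LocalPolicy j)) (t : Fin (D.T + 1)) (h : D.LocalHist i t)
    (hh : D.mixLaw (withOpponents i m ν) (histEvent i t h) ≠ 0) (a : D.A i) :
    (D.mixLaw (withOpponents i m ν))[actionEvent i t a | histEvent i t h] =
      meanActionWeight m t h a / meanWeight m t h := by
  rw [mixLaw_histEvent] at hh
  rw [cond_apply (measurableSet_histEvent i t h), mixLaw_histEvent,
    mixLaw_histEvent_inter_actionEvent, mul_comm, ← div_eq_mul_inv]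
  exact ENNReal.mul_div_mul_right _ _ (right_ne_zero_of_mul hh) (oppWeight_ne_top i ν t h)

/-! ### Possible local histories and well-definedness. -/

/-- A local history is possible if the environment can produce it under suitable actions. -/
def IsPossible (i : D.Agent) (t : Fin (D.T + 1)) (h : D.LocalHist i t) : Prop :=
  ∃ x : D.PreHist t, x.toLocal i = h ∧ x.envWeight ≠ 0

theorem exists_mixLaw_histEvent_ne_zero_iff (hA : ∀ i, Nonempty (D.A i)) (i : D.Agent)
    (m : ProbabilityMeasure (D.LocalPolicy i)) (t : Fin (D.T + 1)) (h : D.LocalHist i t) :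
    (∃ ν, D.mixLaw (withOpponents i m ν) (histEvent i t h) ≠ 0) ↔
      IsPossible i t h ∧ meanWeight m t h ≠ 0 := by
  classical
  simp_rw [mixLaw_histEvent]
  constructor
  · rintro ⟨ν, hν⟩
    refine ⟨?_, left_ne_zero_of_mul hν⟩
    obtain ⟨x, -, hx⟩ := Finset.exists_ne_zero_of_sum_ne_zero (right_ne_zero_of_mul hν)
    have hx := left_ne_zero_of_mul hx
    split_ifs at hx with hx'
    · exact ⟨x, hx', hx⟩
    · exact absurd rfl hx
  · rintro ⟨⟨x, hx, hx0⟩, hm⟩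
    -- Opponents that always play uniformly give every local history of theirs positive path weight.
    refine ⟨fun j => ⟨Measure.dirac fun _ _ => PMF.uniformOfFintype (D.A j), inferInstance⟩,
      mul_ne_zero hm fun h0 => ?_⟩
    have := Finset.sum_eq_zero_iff.mp h0 x (Finset.mem_univ x)
    rw [if_pos hx] at this
    refine mul_ne_zero hx0 (Finset.prod_ne_zero_iff.mpr fun j _ => ?_) this
    rw [ProbabilityMeasure.coe_mk, lintegral_dirac' _ (measurable_pathWeight _ _ _)]
    refine Finset.prod_ne_zero_iff.mpr fun k _ => ?_
    simp

theorem behaviourLocal_apply_of_isPossible (hA : ∀ i, Nonempty (D.A i)) (i : D.Agent)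
    (m : ProbabilityMeasure (D.LocalPolicy i)) (t : Fin (D.T + 1)) (h : D.LocalHist i t)
    (hp : IsPossible i t h) (hm : meanWeight m t h ≠ 0) (a : D.A i) :
    behaviourLocal i m t h a = meanActionWeight m t h a / meanWeight m t h := by
  have hex := (exists_mixLaw_histEvent_ne_zero_iff hA i m t h).mpr ⟨hp, hm⟩
  rw [behaviourLocal, dif_pos hex, PMF.ofFintype_apply]
  exact cond_actionEvent i m _ t h hex.choose_spec a

theorem behaviourLocal_apply_of_not (hA : ∀ i, Nonempty (D.A i)) (i : D.Agent)
    (m : ProbabilityMeasure (D.LocalPolicy i)) (t : Fin (D.T + 1)) (h : D.LocalHist i t)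
    (hp : ¬ (IsPossible i t h ∧ meanWeight m t h ≠ 0)) (a : D.A i) :
    behaviourLocal i m t h a = (Fintype.card (D.A i) : ENNReal)⁻¹ := by
  rw [← exists_mixLaw_histEvent_ne_zero_iff hA i m t h] at hp
  rw [behaviourLocal, dif_neg hp, PMF.uniformOfFintype_apply]

theorem Policy.nonempty_action (π : D.Policy) (i : D.Agent) : Nonempty (D.A i) :=
  ⟨(π i 0 Fin.elim0).support_nonempty.some⟩

/-- The policy corresponding to a distribution over policies is well defined. -/
theorem corresponds_behaviour (μ : ProbabilityMeasure D.Policy) :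
    Corresponds μ (behaviour μ) := by
  have hA : ∀ i, Nonempty (D.A i) := fun i => DecPOMDP.nonempty_action i (marginal μ i)
  intro i t h
  refine ⟨fun ν hν a => ?_, fun h0 a => ?_⟩
  · obtain ⟨hp, hm⟩ := (exists_mixLaw_histEvent_ne_zero_iff hA i _ t h).mp ⟨ν, hν⟩
    rw [cond_actionEvent i _ ν t h hν]
    exact behaviourLocal_apply_of_isPossible hA i _ t h hp hm a
  · refine behaviourLocal_apply_of_not hA i _ t h (fun hh => ?_) a
    obtain ⟨ν, hν⟩ := (exists_mixLaw_histEvent_ne_zero_iff hA i _ t h).mpr hh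
    exact hν (h0 ν)

/-! ### The law of the policy corresponding to a distribution -/

/-- Forget the last step. -/
def PreHist.init {t : ℕ} (x : D.PreHist (t + 1)) : D.PreHist t :=
  (fun k => x.1 k.castSucc, fun k => x.2.1 k.castSucc, fun k => x.2.2 k.castSucc)

theorem PreHist.envWeight_init_ne_zero {t : ℕ} {x : D.PreHist (t + 1)} (hx : x.envWeight ≠ 0) :
    x.init.envWeight ≠ 0 := by
  rw [PreHist.envWeight, Fin.prod_univ_castSucc, ← mul_assoc] at hx
  exact left_ne_zero_of_mul hx

theorem meanActionWeight_le_meanWeight {i : D.Agent} (m : ProbabilityMeasure (D.LocalPolicy i))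
    (t : Fin (D.T + 1)) (h : D.LocalHist i t) (a : D.A i) :
    meanActionWeight m t h a ≤ meanWeight m t h :=
  lintegral_mono fun _ => mul_le_of_le_one_right' (PMF.coe_le_one _ _)

/-- The identity survives where the conditional probability is undefined: if the mean weight
vanishes, so does the smaller `meanActionWeight`, whatever the default value is. -/
theorem meanWeight_mul_behaviourLocal (hA : ∀ i, Nonempty (D.A i)) {i : D.Agent}
    (m : ProbabilityMeasure (D.LocalPolicy i)) (t : Fin (D.T + 1)) (h : D.LocalHist i t)
    (hp : IsPossible i t h) (a : D.A i) :
    meanWeight m t h * behaviourLocal i m t h a = meanActionWeight m t h a := by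
  by_cases hm : meanWeight m t h = 0
  · have := meanActionWeight_le_meanWeight m t h a
    rw [hm] at this
    rw [hm, zero_mul, le_antisymm this bot_le]
  · rw [behaviourLocal_apply_of_isPossible hA i m t h hp hm]
    exact ENNReal.mul_div_cancel hm
      (ne_top_of_le_ne_top ENNReal.one_ne_top (lintegral_pathWeight_le_one _ _ _ _))

/-- The product telescopes, since `meanActionWeight` at a history and action is `meanWeight` of any
one-step extension. The condition `hx` makes all prefixes possible. -/
theorem pathWeight_behaviourLocal (hA : ∀ i, Nonempty (D.A i)) {i : D.Agent}
    (m : ProbabilityMeasure (D.LocalPolicy i)) (t : ℕ) (ht : t < D.T + 1) (x : D.PreHist t)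
    (hx : x.envWeight ≠ 0) :
    pathWeight (behaviourLocal i m) t ht (x.toLocal i) = meanWeight m ⟨t, ht⟩ (x.toLocal i) := by
  induction t with
  | zero => simp [pathWeight, meanWeight]
  | succ t ih =>
    have hx' := PreHist.envWeight_init_ne_zero hx
    have h := ih (Nat.lt_of_succ_lt ht) x.init hx'
    rw [pathWeight_snoc]
    refine (congrArg (· * _) h).trans ((meanWeight_mul_behaviourLocal hA m
      ⟨t, Nat.lt_of_succ_lt ht⟩ (x.init.toLocal i) ⟨x.init, rfl, hx'⟩ _).trans ?_)
    simp only [meanWeight, pathWeight_snoc]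
    rfl

theorem law_apply (π : D.Policy) (τ : D.History) :
    D.law π τ = (dropLast (D := D) τ).envWeight *
      ∏ i, (pathWeight (π i) D.T (Nat.lt_succ_self _) ((dropLast (D := D) τ).toLocal i) *
        π i (Fin.last D.T) ((dropLast (D := D) τ).toLocal i) (τ.action (Fin.last D.T) i)) := by
  refine (histLaw_apply π D.T (Nat.lt_succ_self _) τ).trans ?_
  rw [PMF.piFintype_apply, ← Finset.prod_mul_distrib]
  rfl

/-- The right side is the episode law when the local policies are drawn independently from the
marginals of `μ`; correlations within `μ` are lost. -/
theorem law_behaviour_apply (μ : ProbabilityMeasure D.Policy) (τ : D.History) :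
    D.law (behaviour μ) τ = (dropLast (D := D) τ).envWeight *
      ∏ i, meanActionWeight (marginal μ i) (Fin.last D.T) ((dropLast (D := D) τ).toLocal i)
        (τ.action (Fin.last D.T) i) := by
  have hA : ∀ i, Nonempty (D.A i) := fun i => DecPOMDP.nonempty_action i (marginal μ i)
  rw [law_apply]
  by_cases hx : (dropLast (D := D) τ).envWeight = 0
  · rw [hx, zero_mul, zero_mul]
  · congr 1
    refine Finset.prod_congr rfl fun i _ => ?_
    have h := pathWeight_behaviourLocal hA (marginal μ i) D.T (Nat.lt_succ_self _)
      (dropLast (D := D) τ) hx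
    exact (congrArg (· * _) h).trans
      (meanWeight_mul_behaviourLocal hA _ (Fin.last D.T) _ ⟨_, rfl, hx⟩ _)

/-! ### The other-play distribution -/

/-- The average over profiles of a product is the product of the averages. -/
theorem average_profile_prod (G : D.Agent → D.Aut → ENNReal) :
    ((Fintype.card D.Aut : ENNReal) ^ D.N)⁻¹ * ∑ g : D.Agent → D.Aut, ∏ j, G j (g j) =
      ∏ j, ((Fintype.card D.Aut : ENNReal)⁻¹ * ∑ f, G j f) := by
  classical
  have h := Finset.prod_univ_sum (fun _ : D.Agent => (Finset.univ : Finset D.Aut)) G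
  rw [Fintype.piFinset_univ] at h
  rw [← h, Finset.prod_mul_distrib, Finset.prod_const, Finset.card_univ, Fintype.card_fin,
    ENNReal.inv_pow]

theorem card_inv_mul_sum_one :
    (Fintype.card D.Aut : ENNReal)⁻¹ * ∑ _f : D.Aut, (1 : ENNReal) = 1 := by
  rw [Finset.sum_const, Finset.card_univ, nsmul_eq_mul, mul_one]
  exact ENNReal.inv_mul_cancel (by simp) (by simp)

theorem average_profile_apply (i : D.Agent) (F : D.Aut → ENNReal) :
    ((Fintype.card D.Aut : ENNReal) ^ D.N)⁻¹ * ∑ g : D.Agent → D.Aut, F (g i) =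
      (Fintype.card D.Aut : ENNReal)⁻¹ * ∑ f, F f := by
  classical
  -- All coordinates other than `i` carry the constant one, whose average is one.
  have h := average_profile_prod (D := D) (fun j f => if j = i then F f else 1)
  rw [← Finset.mul_prod_erase Finset.univ _ (Finset.mem_univ i), Finset.prod_eq_one
    (s := Finset.univ.erase i), mul_one] at h
  · simpa using h
  · intro j hj
    simp only [if_neg (Finset.ne_of_mem_erase hj)]
    exact card_inv_mul_sum_one

theorem lintegral_marginal_opDist (π : D.Policy) (i : D.Agent) (F : D.LocalPolicy i → ENNReal)
    (hF : Measurable F) :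
    ∫⁻ σ, F σ ∂(marginal (opDist π) i : Measure (D.LocalPolicy i)) =
      (Fintype.card D.Aut : ENNReal)⁻¹ * ∑ f : D.Aut, F (f.push π i) := by
  rw [marginal, ProbabilityMeasure.toMeasure_map, lintegral_map hF (measurable_pi_apply i), opDist,
    ProbabilityMeasure.coe_mk, lintegral_smul_measure, lintegral_finsetSum_measure]
  have hFi : Measurable fun π : D.Policy => F (π i) := hF.comp (measurable_pi_apply i)
  rw [Finset.sum_congr rfl fun g _ => lintegral_dirac' (pushProfile g π) hFi]
  exact average_profile_apply i fun f => F (f.push π i)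

theorem meanWeight_marginal_opDist (π : D.Policy) (i : D.Agent) (t : Fin (D.T + 1))
    (h : D.LocalHist i t) :
    meanWeight (marginal (opDist π) i) t h =
      (Fintype.card D.Aut : ENNReal)⁻¹ * ∑ f : D.Aut, pathWeight (f.push π i) t t.2 h :=
  lintegral_marginal_opDist π i _ (measurable_pathWeight _ _ _)

theorem meanActionWeight_marginal_opDist (π : D.Policy) (i : D.Agent) (t : Fin (D.T + 1))
    (h : D.LocalHist i t) (a : D.A i) :
    meanActionWeight (marginal (opDist π) i) t h a =
      (Fintype.card D.Aut : ENNReal)⁻¹ *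
        ∑ f : D.Aut, pathWeight (f.push π i) t t.2 h * f.push π i t h a :=
  lintegral_marginal_opDist π i _
    ((measurable_pathWeight _ _ _).mul (measurable_localPolicy_apply _ _ _))

/-- Here independence of the coordinates of `g` enters: it turns the product of averages given by
`law_behaviour_apply` into an average of products. -/
theorem law_symmetrizer_apply (π : D.Policy) (τ : D.History) :
    D.law (symmetrizer π) τ =
      ((Fintype.card D.Aut : ENNReal) ^ D.N)⁻¹ *
        ∑ g : D.Agent → D.Aut, D.law (pushProfile g π) τ := by
  rw [symmetrizer, law_behaviour_apply]
  simp_rw [law_apply, meanActionWeight_marginal_opDist]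
  rw [← Finset.mul_sum, mul_left_comm]
  exact congrArg _ (average_profile_prod _).symm

theorem J_eq_sum (π : D.Policy) :
    D.J π = ∑ τ : D.History, (D.law π τ).toReal * τ.totalReward := by
  have : MeasurableSingletonClass D.History := ⟨fun _ => MeasurableSpace.measurableSet_top⟩
  rw [J, PMF.integral_eq_sum]
  rfl

theorem JOP_eq_J_symmetrizer (π : D.Policy) : D.JOP π = D.J (symmetrizer π) := by
  simp_rw [JOP, J_eq_sum]
  rw [Finset.sum_comm, Finset.sum_div]
  refine Finset.sum_congr rfl fun τ _ => ?_
  rw [law_symmetrizer_apply, ENNReal.toReal_mul,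
    ENNReal.toReal_sum fun g _ => PMF.apply_ne_top _ _, ← Finset.sum_mul]
  simp only [Fintype.card_pi, Finset.prod_const, Finset.card_univ, Fintype.card_fin,
    ENNReal.toReal_inv, ENNReal.toReal_pow, ENNReal.toReal_natCast, Nat.cast_pow]
  ring

/-! ### Invariance -/

theorem _root_.Equiv.piCongr_trans_apply {α β γ : Type*} {X : α → Type*} {Y : β → Type*}
    {Z : γ → Type*} (e₁ : α ≃ β) (e₂ : β ≃ γ) (k₁ : ∀ a, X a ≃ Y (e₁ a)) (k₂ : ∀ b, Y b ≃ Z (e₂ b))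
    (x : ∀ a, X a) :
    (e₁.trans e₂).piCongr (fun a => (k₁ a).trans (k₂ (e₁ a))) x =
      e₂.piCongr k₂ (e₁.piCongr k₁ x) := by
  funext c
  obtain ⟨a, rfl⟩ := (e₁.trans e₂).surjective c
  rw [Equiv.piCongr_apply_apply]
  simp only [Equiv.trans_apply]
  rw [Equiv.piCongr_apply_apply, Equiv.piCongr_apply_apply]
  rfl

/-- The composition of automorphisms. -/
def Aut.comp (f g : D.Aut) : D.Aut where
  onAgent := g.onAgent.trans f.onAgent
  onState := g.onState.trans f.onState
  onAction i := (g.onAction i).trans (f.onAction (g.onAgent i))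
  onObs i := (g.onObs i).trans (f.onObs (g.onAgent i))
  trans_eq s s' a := by
    rw [g.trans_eq, f.trans_eq, Equiv.piCongr_trans_apply]
    rfl
  obs_eq s a o := by
    rw [g.obs_eq, f.obs_eq, Equiv.piCongr_trans_apply, Equiv.piCongr_trans_apply]
    rfl
  reward_eq s a := by
    rw [g.reward_eq, f.reward_eq, Equiv.piCongr_trans_apply]
    rfl
  b₀_eq s := by
    rw [g.b₀_eq, f.b₀_eq]
    rfl

/-- With finiteness this makes left translation by `f` a permutation, which is all of the group
structure that the invariance proof needs. -/
theorem Aut.comp_injective (f : D.Aut) : Function.Injective f.comp := by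
  rintro ⟨a, b, c, d, _, _, _, _⟩ ⟨a', b', c', d', _, _, _, _⟩ h
  simp only [Aut.comp, Aut.mk.injEq] at h
  obtain ⟨h1, h2, h3, h4⟩ := h
  have ha : a = a' := Equiv.ext fun i => f.onAgent.injective (congrArg (fun e => e i) h1)
  have hb : b = b' := Equiv.ext fun i => f.onState.injective (congrArg (fun e => e i) h2)
  subst ha hb
  have hc : c = c' := funext fun i => Equiv.ext fun y => (f.onAction _).injective
    (congrArg (fun e => e y) (congrFun (eq_of_heq h3) i))
  have hd : d = d' := funext fun i => Equiv.ext fun y => (f.onObs _).injective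
    (congrArg (fun e => e y) (congrFun (eq_of_heq h4) i))
  subst hc hd
  rfl

theorem Aut.comp_bijective (f : D.Aut) : Function.Bijective f.comp :=
  Finite.injective_iff_bijective.mp f.comp_injective

/-! ### Automorphisms acting on histories and on mean weights. -/

/-- The action of an automorphism on local histories. -/
def Aut.onLocalHist (f : D.Aut) (i : D.Agent) (t : ℕ) :
    D.LocalHist i t ≃ D.LocalHist (f.onAgent i) t :=
  Equiv.arrowCongr (Equiv.refl _) ((f.onAction i).prodCongr (f.onObs i))

theorem Aut.push_apply_onLocalHist (f : D.Aut) (π : D.Policy) (i : D.Agent) (t : Fin (D.T + 1))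
    (h : D.LocalHist i t) (a : D.A i) :
    f.push π (f.onAgent i) t (f.onLocalHist i t h) (f.onAction i a) = π i t h a :=
  f.push_apply π i t h a

/-- Every agent, local history and action is an image under `f`, so it suffices to compare values at
images, without handling inverses. -/
theorem Aut.eq_push_of_forall (f : D.Aut) (π ρ : D.Policy)
    (H : ∀ (i : D.Agent) (t : Fin (D.T + 1)) (h : D.LocalHist i t) (a : D.A i),
      ρ (f.onAgent i) t (f.onLocalHist i t h) (f.onAction i a) = π i t h a) :
    f.push π = ρ := by
  funext j t h
  obtain ⟨i, rfl⟩ := f.onAgent.surjective j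
  obtain ⟨h, rfl⟩ := (f.onLocalHist i t).surjective h
  refine PMF.ext fun a => ?_
  obtain ⟨a, rfl⟩ := (f.onAction i).surjective a
  rw [H, f.push_apply_onLocalHist]

theorem Aut.push_comp (f g : D.Aut) (π : D.Policy) : (f.comp g).push π = f.push (g.push π) :=
  (f.comp g).eq_push_of_forall _ _ fun i t h a => by
    rw [← g.push_apply_onLocalHist π i t h a, ← f.push_apply_onLocalHist (g.push π)]
    rfl

theorem Aut.pathWeight_push (f : D.Aut) (π : D.Policy) (i : D.Agent) (t : ℕ) (ht : t < D.T + 1)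
    (h : D.LocalHist i t) :
    pathWeight (f.push π (f.onAgent i)) t ht (f.onLocalHist i t h) = pathWeight (π i) t ht h :=
  Finset.prod_congr rfl fun k _ =>
    f.push_apply_onLocalHist π i ⟨k, k.2.trans ht⟩ (fun j => h ⟨j, j.2.trans k.2⟩) (h k).1

theorem Aut.meanWeight_opDist (f : D.Aut) (π : D.Policy) (i : D.Agent) (t : Fin (D.T + 1))
    (h : D.LocalHist i t) :
    meanWeight (marginal (opDist π) (f.onAgent i)) t (f.onLocalHist i t h) =
      meanWeight (marginal (opDist π) i) t h := by
  -- The sum on the left is reindexed by `g ↦ f.comp g`, after which the terms agree one by one.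
  rw [meanWeight_marginal_opDist, meanWeight_marginal_opDist, ← f.comp_bijective.sum_comp]
  simp_rw [Aut.push_comp, Aut.pathWeight_push]

theorem Aut.meanActionWeight_opDist (f : D.Aut) (π : D.Policy) (i : D.Agent) (t : Fin (D.T + 1))
    (h : D.LocalHist i t) (a : D.A i) :
    meanActionWeight (marginal (opDist π) (f.onAgent i)) t (f.onLocalHist i t h)
        (f.onAction i a) =
      meanActionWeight (marginal (opDist π) i) t h a := by
  rw [meanActionWeight_marginal_opDist, meanActionWeight_marginal_opDist,
    ← f.comp_bijective.sum_comp]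
  simp_rw [Aut.push_comp, Aut.pathWeight_push, Aut.push_apply_onLocalHist]

/-- The action of an automorphism on histories without last joint action. -/
def Aut.onPreHist (f : D.Aut) (t : ℕ) : D.PreHist t ≃ D.PreHist t :=
  (Equiv.arrowCongr (Equiv.refl _) f.onState).prodCongr
    ((Equiv.arrowCongr (Equiv.refl _) (f.onAgent.piCongr f.onAction)).prodCongr
      (Equiv.arrowCongr (Equiv.refl _) (f.onAgent.piCongr f.onObs)))

theorem Aut.envWeight_onPreHist (f : D.Aut) {t : ℕ} (x : D.PreHist t) :
    (f.onPreHist t x).envWeight = x.envWeight := by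
  rw [PreHist.envWeight, PreHist.envWeight, f.b₀_eq (x.1 0)]
  refine congrArg₂ (· * ·) rfl (Finset.prod_congr rfl fun k _ => ?_)
  rw [f.trans_eq (x.1 k.castSucc), f.obs_eq (x.1 k.succ)]
  rfl

theorem Aut.toLocal_onPreHist (f : D.Aut) {t : ℕ} (x : D.PreHist t) (i : D.Agent) :
    (f.onPreHist t x).toLocal (f.onAgent i) = f.onLocalHist i t (x.toLocal i) := by
  funext k
  exact Prod.ext (f.onAgent.piCongr_apply_apply f.onAction (x.2.1 k) i)
    (f.onAgent.piCongr_apply_apply f.onObs (x.2.2 k) i)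

theorem Aut.isPossible_iff (f : D.Aut) (i : D.Agent) (t : Fin (D.T + 1)) (h : D.LocalHist i t) :
    IsPossible (f.onAgent i) t (f.onLocalHist i t h) ↔ IsPossible i t h := by
  rw [IsPossible, (f.onPreHist t).surjective.exists, IsPossible]
  simp_rw [f.toLocal_onPreHist, f.envWeight_onPreHist, (f.onLocalHist i t).injective.eq_iff]

theorem isInvariant_symmetrizer (π : D.Policy) : IsInvariant (symmetrizer π) := by
  refine fun f => f.eq_push_of_forall _ _ fun i t h a => ?_
  have hA := Policy.nonempty_action π
  simp only [symmetrizer, behaviour]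
  by_cases hp : IsPossible i t h ∧ meanWeight (marginal (opDist π) i) t h ≠ 0
  · rw [behaviourLocal_apply_of_isPossible hA i _ t h hp.1 hp.2,
      behaviourLocal_apply_of_isPossible hA _ _ t _ ((f.isPossible_iff i t h).mpr hp.1)
        (by rw [f.meanWeight_opDist]; exact hp.2),
      f.meanWeight_opDist, f.meanActionWeight_opDist]
  -- Both sides take the uniform default, and `f` matches the two action sets, which thus have equal
  -- size.
  · rw [behaviourLocal_apply_of_not hA i _ t h hp, behaviourLocal_apply_of_not hA _ _ t _
        (by rwa [f.meanWeight_opDist, f.isPossible_iff]), Fintype.card_congr (f.onAction i)]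

theorem JOP_eq_J_of_isInvariant {π : D.Policy} (hπ : IsInvariant π) : D.JOP π = D.J π := by
  have h : ∀ g : D.Agent → D.Aut, pushProfile g π = π := fun g =>
    funext fun i => congrFun (hπ (g i)) i
  simp_rw [JOP, h, Finset.sum_const, nsmul_eq_mul, Finset.card_univ]
  exact mul_div_cancel_left₀ _ (Nat.cast_ne_zero.mpr Fintype.card_ne_zero)

end DecPOMDP

theorem mainTheorem5 (D : DecPOMDP.{u, v, w}) :
    (∀ π : D.Policy,
      DecPOMDP.Corresponds (DecPOMDP.opDist π) (DecPOMDP.symmetrizer π) ∧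
      DecPOMDP.IsInvariant (DecPOMDP.symmetrizer π) ∧
      D.JOP π = D.J (DecPOMDP.symmetrizer π)) ∧
    (∃ Jquot : Quotient D.opSetoid → ℝ, ∀ π : D.Policy, Jquot (Quotient.mk _ π) = D.JOP π) ∧
    ((∃ π : D.Policy, D.IsOPOptimal π) →
      ∃ π : D.Policy, D.IsOPOptimal π ∧ DecPOMDP.IsInvariant π) := by
  refine ⟨fun π => ⟨DecPOMDP.corresponds_behaviour _, DecPOMDP.isInvariant_symmetrizer π,
    DecPOMDP.JOP_eq_J_symmetrizer π⟩, ⟨Quotient.lift D.JOP fun π π' h => ?_, fun _ => rfl⟩, ?_⟩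
  · have h : DecPOMDP.symmetrizer π = DecPOMDP.symmetrizer π' := h
    rw [DecPOMDP.JOP_eq_J_symmetrizer, DecPOMDP.JOP_eq_J_symmetrizer, h]
  · rintro ⟨π, hπ⟩
    have hinv := DecPOMDP.isInvariant_symmetrizer π
    refine ⟨DecPOMDP.symmetrizer π, fun π' => ?_, hinv⟩
    -- For the symmetrized policy, other-play value, self-play value and the other-play value of `π`
    -- all agree.
    rw [DecPOMDP.JOP_eq_J_of_isInvariant hinv, ← DecPOMDP.JOP_eq_J_symmetrizer]
    exact hπ π'
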